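/- Let $R$ be a commutative noetherian ring and let $\mathscr{S}$ be a Serre subcategory of the category of $R$-modules, i.e. a class of $R$-modules that contains $0$ and is closed under submodules, factor modules and extensions. Let $I=(x_1,\dots,x_k)$ and $J=(y_1,\dots,y_l)$ be ideals of $R$ with $\sqrt{I}=\sqrt{J}$, given with arbitrary finite systems of generators, and let $K(I)$ and $K(J)$ denote the Koszul complexes of $x_1,\dots,x_k$ and of $y_1,\dots,y_l$. For an $R$-module $M$ write $H^i(K(I),M):=H^i(\operatorname{Hom}_R(K(I),M))$, and similarly for $J$. Then for every $R$-module $M$ (not necessarily finitely generated) and every integer $n\ge 0$ the following assertions are equivalent: 1. $\operatorname{Ext}^i_R(R/I,M)\in\mathscr{S}$ for $0\le i\le n$; 2. $\operatorname{Ext}^i_R(R/J,M)\in\mathscr{S}$ for $0\le i\le n$; 3. $H^i(K(I),M)\in\mathscr{S}$ for $0\le i\le n$; 4. $H^i(K(J),M)\in\mathscr{S}$ for $0\le i\le n$. -/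

import Mathlib

open CategoryTheory

universe u

section Koszul

variable {R : Type u} [CommRing R]

/-- Contraction with a linear form lowers the degree in the exterior algebra by one. -/
theorem contractLeft_mem_exteriorPower {L : Type u} [AddCommGroup L] [Module R L]
    (φ : Module.Dual R L) (p : ℕ) :
    ∀ ω ∈ ⋀[R]^(p + 1) L,
      CliffordAlgebra.contractLeft (Q := (0 : QuadraticForm R L)) φ ω ∈ ⋀[R]^p L := by
  induction p with
  | zero =>
    intro ω hω
    simp only [ExteriorAlgebra.exteriorPower, zero_add, pow_one, pow_zero] at hω ⊢
    obtain ⟨v, rfl⟩ := hω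
    exact Submodule.mem_one.mpr ⟨φ v, (CliffordAlgebra.contractLeft_ι (Q := 0) φ v).symm⟩
  | succ p ih =>
    intro ω hω
    rw [ExteriorAlgebra.exteriorPower, pow_succ'] at hω
    induction hω using Submodule.mul_induction_on' with
    | mem_mul_mem m hm b hb =>
      obtain ⟨v, rfl⟩ := hm
      have h := CliffordAlgebra.contractLeft_ι_mul (Q := (0 : QuadraticForm R L)) (d := φ) v b
      refine (congrArg (· ∈ ⋀[R]^(p + 1) L) h).mpr ?_
      refine Submodule.sub_mem _ (Submodule.smul_mem _ _ hb) ?_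
      rw [ExteriorAlgebra.exteriorPower, pow_succ']
      exact Submodule.mul_mem_mul ⟨v, rfl⟩ (ih b hb)
    | add a _ b _ ha hb =>
      rw [map_add]
      exact Submodule.add_mem _ ha hb

/-- The Koszul differential `⋀^(p+1) L → ⋀^p L` of a linear form `φ : L → R`,
`v₀ ∧ ⋯ ∧ v_p ↦ ∑ (-1)^i φ(v_i) v₀ ∧ ⋯ ∧ v̂_i ∧ ⋯ ∧ v_p`: the contraction with `φ`. -/
noncomputable def koszulD {L : Type u} [AddCommGroup L] [Module R L]
    (φ : Module.Dual R L) (p : ℕ) : ⋀[R]^(p + 1) L →ₗ[R] ⋀[R]^p L :=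
  (CliffordAlgebra.contractLeft (Q := (0 : QuadraticForm R L)) φ).restrict
    (contractLeft_mem_exteriorPower φ p)

theorem koszulD_comp_koszulD {L : Type u} [AddCommGroup L] [Module R L]
    (φ : Module.Dual R L) (p : ℕ) : koszulD φ p ∘ₗ koszulD φ (p + 1) = 0 := by
  refine LinearMap.ext fun ω => ?_
  exact Subtype.ext (CliffordAlgebra.contractLeft_contractLeft (Q := 0) φ ω.1)

/-- The Koszul complex `K(x₁, …, x_k)` of a finite sequence of elements of `R`: in degree `p` it is
the exterior power `⋀^p (R^k)`, and the differential is that of the linear form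
`R^k → R`, `v ↦ ∑ v_i x_i`. -/
noncomputable def koszulComplex {k : ℕ} (x : Fin k → R) : ChainComplex (ModuleCat.{u} R) ℕ :=
  ChainComplex.of (fun p => ModuleCat.of R (⋀[R]^p (Fin k → R)))
    (fun p => ModuleCat.ofHom (koszulD (Fintype.linearCombination R x) p))
    (fun p => by
      rw [← ModuleCat.ofHom_comp, koszulD_comp_koszulD]
      rfl)

/-- The Koszul cohomology `H^i(K(x), M) = H^i(Hom_R(K(x), M))`, as an `R`-module. -/
noncomputable def koszulCohomology {k : ℕ} (x : Fin k → R) (M : ModuleCat.{u} R) (i : ℕ) :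
    ModuleCat.{u} R :=
  ((koszulComplex x).linearYonedaObj R M).homology i

end Koszul

/-- `Ext^i_R(N, M)`, as an `R`-module. -/
noncomputable def extModule {R : Type u} [CommRing R] (N M : ModuleCat.{u} R) (i : ℕ) :
    ModuleCat.{u} R :=
  ModuleCat.of R (Abelian.Ext.{u} N M i)

/-! Two facts carry the proof. First, by dévissage, if `Ext^i(R/I, M)` lies in the Serre class for
`i ≤ n`, so does `Ext^n(N, M)` for every finitely generated `N` supported in `V(I)`
(`serre_extModule_of_le_radical_annihilator`). Taking `N = R/J`, and then exchanging `I` and `J`,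
compares the two Ext conditions. Second, the Koszul complex consists of finite projectives, has `H_0
= R/I`, and its homology is finitely generated and killed by `I`. Cut it into short exact sequences
through cokernels and images: modulo the class, dimension shifting identifies `H^n(Hom(K, M))` with
`Ext^n(H_0, M)`, with errors `Ext^j(H_p, M)`, `p ≥ 1`, `j < n`
(`serre_linearYonedaObj_homology_iff`). The first fact puts these errors in the class once
`Ext^i(R/I, M)` is there for `i < n`, so induction on the degree finishes. -/

namespace LinearMap

variable {R A B C : Type*} [CommRing R] [AddCommGroup A] [AddCommGroup B] [AddCommGroup C]
  [Module R A] [Module R B] [Module R C]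

/-- A linear map factors through a surjection whose kernel it kills. -/
theorem exists_comp_eq_of_surjective (p : A →ₗ[R] B) (hp : Function.Surjective p)
    (f : A →ₗ[R] C) (h : ∀ a, p a = 0 → f a = 0) : ∃ g : B →ₗ[R] C, ∀ a, g (p a) = f a := by
  refine ⟨(ker p).liftQ f h ∘ₗ (p.quotKerEquivOfSurjective hp).symm.toLinearMap, fun a => ?_⟩
  have : (p.quotKerEquivOfSurjective hp).symm (p a) = (ker p).mkQ a := by
    rw [LinearEquiv.symm_apply_eq]
    rfl
  rw [LinearMap.comp_apply, LinearEquiv.coe_coe, this]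
  rfl

/-- Third isomorphism theorem: `H = A/X` contains `E = Y/X`, and the quotient `A/Y` embeds in `N`.
-/
theorem exists_injective_exact {X Y E N H : Type*} [AddCommGroup X] [AddCommGroup Y]
    [AddCommGroup E] [AddCommGroup N] [AddCommGroup H] [Module R X] [Module R Y] [Module R E]
    [Module R N] [Module R H] (j : X →ₗ[R] Y) (δ : Y →ₗ[R] E) (c : Y →ₗ[R] A) (r : A →ₗ[R] N)
    (π : A →ₗ[R] H) (hδ : Function.Surjective δ) (hjδ : Function.Exact j δ)
    (hc : Function.Injective c) (hcr : Function.Exact c r) (hπ : Function.Surjective π)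
    (hπ₀ : ∀ z, π z = 0 ↔ ∃ v, c (j v) = z) :
    ∃ (α : E →ₗ[R] H) (β : H →ₗ[R] N), Function.Injective α ∧ Function.Exact α β := by
  obtain ⟨α, hα⟩ := δ.exists_comp_eq_of_surjective hδ (π ∘ₗ c) fun z hz => by
    obtain ⟨v, rfl⟩ := (hjδ z).mp hz
    exact (hπ₀ _).mpr ⟨v, rfl⟩
  obtain ⟨β, hβ⟩ := π.exists_comp_eq_of_surjective hπ r fun z hz => by
    obtain ⟨v, rfl⟩ := (hπ₀ z).mp hz
    exact hcr.apply_apply_eq_zero _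
  refine ⟨α, β, ?_, fun z => ⟨fun hz => ?_, ?_⟩⟩
  · rw [injective_iff_map_eq_zero]
    intro z hz
    obtain ⟨z, rfl⟩ := hδ z
    rw [hα] at hz
    obtain ⟨v, hv⟩ := (hπ₀ _).mp hz
    rw [← hc hv, hjδ.apply_apply_eq_zero]
  · obtain ⟨z, rfl⟩ := hπ z
    rw [hβ] at hz
    obtain ⟨v, rfl⟩ := (hcr z).mp hz
    exact ⟨δ v, hα v⟩
  · rintro ⟨z, rfl⟩
    obtain ⟨z, rfl⟩ := hδ z
    rw [hα]
    exact (hβ _).trans (hcr.apply_apply_eq_zero z)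

end LinearMap

/-! ### Serre classes and the long exact Ext sequence. -/

section SerreClass

variable {R : Type u} [CommRing R] (S : ObjectProperty (ModuleCat.{u} R)) [S.IsSerreClass]

theorem serre_of_exact {A B C : Type u} [AddCommGroup A] [AddCommGroup B] [AddCommGroup C]
    [Module R A] [Module R B] [Module R C] (f : A →ₗ[R] B) (g : B →ₗ[R] C)
    (h : Function.Exact f g) (hA : S (.of R A)) (hC : S (.of R C)) : S (.of R B) :=
  S.prop_X₂_of_exact (ModuleCat.shortComplex_exact
    (ModuleCat.shortComplexOfCompEqZero f g h.linearMap_comp_eq_zero) h) hA hC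

theorem serre_of_injective {A B : Type u} [AddCommGroup A] [AddCommGroup B]
    [Module R A] [Module R B] (f : A →ₗ[R] B) (h : Function.Injective f)
    (hB : S (.of R B)) : S (.of R A) :=
  have : Mono (ModuleCat.ofHom f) := (ModuleCat.mono_iff_injective _).mpr h
  S.prop_of_mono (ModuleCat.ofHom f) hB

theorem serre_of_surjective {A B : Type u} [AddCommGroup A] [AddCommGroup B]
    [Module R A] [Module R B] (f : A →ₗ[R] B) (h : Function.Surjective f)
    (hA : S (.of R A)) : S (.of R B) :=
  have : Epi (ModuleCat.ofHom f) := (ModuleCat.epi_iff_surjective _).mpr h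
  S.prop_of_epi (ModuleCat.ofHom f) hA

theorem serre_of_subsingleton (A : Type u) [AddCommGroup A] [Module R A] [Subsingleton A] :
    S (.of R A) :=
  S.prop_of_isZero (ModuleCat.isZero_of_subsingleton _)

variable {S} {M : ModuleCat.{u} R}

theorem serre_extModule_of_iso {N N' : ModuleCat.{u} R} (e : N ≅ N') {n : ℕ}
    (h : S (extModule N M n)) : S (extModule N' M n) := by
  refine serre_of_injective S ((Abelian.Ext.mk₀ e.hom).precompOfLinear R M (zero_add n)) ?_ h
  intro a b hab
  have := congrArg (fun z => (Abelian.Ext.mk₀ e.inv).comp z (zero_add n)) hab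
  simpa using this

variable {T : ShortComplex (ModuleCat.{u} R)}

theorem extModule_exact_X₂ (hT : T.ShortExact) (n : ℕ) :
    Function.Exact ((Abelian.Ext.mk₀ T.g).precompOfLinear R M (zero_add n))
      ((Abelian.Ext.mk₀ T.f).precompOfLinear R M (zero_add n)) := by
  refine fun z => ⟨fun hz => Abelian.Ext.contravariant_sequence_exact₂ hT M z hz, ?_⟩
  rintro ⟨w, rfl⟩
  simp

theorem extModule_exact_X₃ (hT : T.ShortExact) (n : ℕ) :
    Function.Exact (hT.extClass.precompOfLinear R M (add_comm 1 n))
      ((Abelian.Ext.mk₀ T.g).precompOfLinear R M (zero_add (n + 1))) := by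
  refine fun z =>
    ⟨fun hz => Abelian.Ext.contravariant_sequence_exact₃ hT M z hz (add_comm 1 n), ?_⟩
  rintro ⟨w, rfl⟩
  simp

theorem extModule_exact_X₁ (hT : T.ShortExact) (n : ℕ) :
    Function.Exact ((Abelian.Ext.mk₀ T.f).precompOfLinear R M (zero_add n))
      (hT.extClass.precompOfLinear R M (add_comm 1 n)) := by
  refine fun z =>
    ⟨fun hz => Abelian.Ext.contravariant_sequence_exact₁ hT M z (add_comm 1 n) hz, ?_⟩
  rintro ⟨w, rfl⟩
  simp

theorem serre_extModule_X₂ (hT : T.ShortExact) {n : ℕ} (h₃ : S (extModule T.X₃ M n))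
    (h₁ : S (extModule T.X₁ M n)) :
    S (extModule T.X₂ M n) :=
  serre_of_exact S _ _ (extModule_exact_X₂ hT n) h₃ h₁

theorem serre_extModule_X₃ (hT : T.ShortExact) {n : ℕ} (h₁ : S (extModule T.X₁ M n))
    (h₂ : S (extModule T.X₂ M (n + 1))) : S (extModule T.X₃ M (n + 1)) :=
  serre_of_exact S _ _ (extModule_exact_X₃ hT n) h₁ h₂

theorem serre_extModule_X₁ (hT : T.ShortExact) {n : ℕ} (h₂ : S (extModule T.X₂ M n))
    (h₃ : S (extModule T.X₃ M (n + 1))) : S (extModule T.X₁ M n) :=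
  serre_of_exact S _ _ (extModule_exact_X₁ hT n) h₂ h₃

theorem serre_extModule_X₃_zero (hT : T.ShortExact) (h₂ : S (extModule T.X₂ M 0)) :
    S (extModule T.X₃ M 0) :=
  have := hT.epi_g
  serre_of_injective S ((Abelian.Ext.mk₀ T.g).precompOfLinear R M (zero_add 0))
    (Abelian.Ext.precomp_mk₀_injective_of_epi M T.g) h₂

theorem serre_extModule_succ_iff (hT : T.ShortExact) [Projective T.X₂] {n : ℕ} :
    S (extModule T.X₃ M (n + 2)) ↔ S (extModule T.X₁ M (n + 1)) := by
  have h (n : ℕ) : S (extModule T.X₂ M (n + 1)) :=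
    have : Subsingleton (Abelian.Ext.{u} T.X₂ M (n + 1)) :=
      Abelian.Ext.subsingleton_of_projective T.X₂ M n
    serre_of_subsingleton S _
  exact ⟨fun h₃ => serre_extModule_X₁ hT (h n) h₃, fun h₁ => serre_extModule_X₃ hT h₁ (h _)⟩

end SerreClass

/-! ### Dévissage over a noetherian ring. -/

section Noetherian

variable {R : Type u} [CommRing R] [IsNoetherianRing R]
  {S : ObjectProperty (ModuleCat.{u} R)} [S.IsSerreClass] {M : ModuleCat.{u} R}

/-- A prime filtration of `N` has factors `R/p` with `p ⊇ Ann N`, hence `p ⊇ I`; the middle of the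
Ext sequence handles extensions. -/
theorem serre_extModule_of_prime (I : Ideal R) (n : ℕ)
    (hI : ∀ p : Ideal R, p.IsPrime → I ≤ p → S (extModule (.of R (R ⧸ p)) M n))
    (N : Type u) [AddCommGroup N] [Module R N] [hfin : Module.Finite R N]
    (hN : I ≤ (Module.annihilator R N).radical) : S (extModule (.of R N) M n) := by
  revert hN
  induction hfin using IsNoetherianRing.induction_on_isQuotientEquivQuotientPrime R with
  | subsingleton N =>
    intro _
    have : Subsingleton (Abelian.Ext.{u} (.of R N) M n) :=
      subsingleton_of_forall_eq 0 fun z => by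
        rw [← Abelian.Ext.mk₀_id_comp z,
          (ModuleCat.isZero_of_subsingleton (ModuleCat.of R N)).eq_of_src (𝟙 _) 0]
        simp
    exact serre_of_subsingleton S _
  | quotient N p e =>
    intro hN
    rw [e.annihilator_eq, Ideal.annihilator_quotient, p.2.radical] at hN
    exact serre_extModule_of_iso e.symm.toModuleIso (hI p.1 p.2 hN)
  | exact N₁ N₂ N₃ f g hf hg hfg h₁ h₃ =>
    intro hN
    refine serre_extModule_X₂ (T := ModuleCat.shortComplexOfCompEqZero f g
      hfg.linearMap_comp_eq_zero) (ModuleCat.shortComplex_shortExact _ hfg hf hg)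
      (h₃ (hN.trans ?_)) (h₁ (hN.trans ?_))
    · exact Ideal.radical_mono (g.annihilator_le_of_surjective hg)
    · exact Ideal.radical_mono (f.annihilator_le_of_injective hf)

/-- If `Ext^i(R/I, M)` lies in a Serre class for `i ≤ n`, then so does `Ext^n(N, M)` for every
finitely generated `N` with support in `V(I)`. -/
theorem serre_extModule_of_le_radical_annihilator (I : Ideal R) (n : ℕ)
    (hI : ∀ i ≤ n, S (extModule (.of R (R ⧸ I)) M i))
    (N : Type u) [AddCommGroup N] [Module R N] [Module.Finite R N]
    (hN : I ≤ (Module.annihilator R N).radical) : S (extModule (.of R N) M n) := by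
  induction n generalizing N with
  | zero =>
    refine serre_extModule_of_prime I 0 (fun p _ hp => ?_) N hN
    exact serre_extModule_X₃_zero
      (LinearMap.shortExact_shortComplexKer (Submodule.factor_surjective hp)) (hI 0 le_rfl)
  | succ n ih =>
    refine serre_extModule_of_prime I (n + 1) (fun p _ hp => ?_) N hN
    -- The kernel of `R/I → R/p` is finitely generated and killed by `I`, so induction covers its
    -- `Ext^n`.
    refine serre_extModule_X₃
      (LinearMap.shortExact_shortComplexKer (Submodule.factor_surjective hp)) ?_ (hI _ le_rfl)
    refine ih (fun i hi => hI i (hi.trans n.le_succ)) _ (le_trans ?_ Ideal.le_radical)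
    exact (Ideal.annihilator_quotient (I := I)).ge.trans
      (LinearMap.annihilator_le_of_injective _ (Submodule.injective_subtype _))

end Noetherian

/-! ### Cohomology of `Hom(-, M)` at one spot of a complex. -/

section HomCohomology

variable {R : Type u} [CommRing R] {S : ObjectProperty (ModuleCat.{u} R)} [S.IsSerreClass]
  {M : ModuleCat.{u} R}

theorem linearEquiv₀_mk₀_comp {A B : ModuleCat.{u} R} (p : A ⟶ B) (z : Abelian.Ext B M 0) :
    Abelian.Ext.linearEquiv₀ (R := R) ((Abelian.Ext.mk₀ p).comp z (zero_add 0)) =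
      p ≫ Abelian.Ext.linearEquiv₀ (R := R) z := by
  obtain ⟨u, rfl⟩ := (Abelian.Ext.linearEquiv₀ (R := R)).symm.surjective z
  rw [LinearEquiv.apply_symm_apply, ← LinearEquiv.eq_symm_apply]
  simp

/-- If the cocycles of `T` are the morphisms `B ⟶ M` that vanish on `A`, then the homology of `T`
is a quotient of the morphisms from the cokernel of `A ⟶ B` to `M`. -/
theorem exists_ext_zero_to_homology {A B : ModuleCat.{u} R} (f : A ⟶ B)
    (T : ShortComplex (ModuleCat.{u} R))
    (e : (B ⟶ M) ≃ₗ[R] T.X₂) (he : ∀ u : B ⟶ M, T.g (e u) = 0 ↔ f ≫ u = 0) :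
    ∃ π : extModule (.of R (B ⧸ LinearMap.range f.hom)) M 0 →ₗ[R] T.homology,
      Function.Surjective π ∧ ∀ z, π z = 0 ↔ ∃ t, T.f t =
        e (ModuleCat.ofHom (LinearMap.range f.hom).mkQ ≫ Abelian.Ext.linearEquiv₀ (R := R) z) := by
  let Q := ModuleCat.of R (B ⧸ LinearMap.range f.hom)
  let q : B ⟶ Q := ModuleCat.ofHom (LinearMap.range f.hom).mkQ
  have hfq : f ≫ q = 0 := by
    ext a
    exact (Submodule.Quotient.mk_eq_zero _).mpr ⟨a, rfl⟩
  let e₀ : Abelian.Ext Q M 0 ≃ₗ[R] (Q ⟶ M) := Abelian.Ext.linearEquiv₀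
  let κ : Abelian.Ext Q M 0 →ₗ[R] LinearMap.ker T.g.hom :=
    LinearMap.codRestrict _ ((e : (B ⟶ M) →ₗ[R] T.X₂) ∘ₗ
      (Linear.leftComp R M q : (Q ⟶ M) →ₗ[R] (B ⟶ M)) ∘ₗ
      (e₀ : Abelian.Ext Q M 0 →ₗ[R] (Q ⟶ M))) fun z => (he _).mpr <| by
        change f ≫ q ≫ _ = 0
        rw [← Category.assoc, hfq, Limits.zero_comp]
  have hκ : Function.Surjective κ := by
    rintro ⟨t, ht⟩
    obtain ⟨u, rfl⟩ := e.surjective t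
    have hu : f ≫ u = 0 := (he u).mp ht
    let v : Q ⟶ M := ModuleCat.ofHom ((LinearMap.range f.hom).liftQ u.hom (by
      rintro _ ⟨a, rfl⟩
      exact congrArg (fun w => w.hom a) hu))
    refine ⟨e₀.symm v, Subtype.ext ?_⟩
    change e (q ≫ e₀ (e₀.symm v)) = e u
    rw [LinearEquiv.apply_symm_apply]
    rfl
  let ε := T.moduleCatHomologyIso.symm.toLinearEquiv
  refine ⟨ε.toLinearMap ∘ₗ (LinearMap.range T.moduleCatToCycles).mkQ ∘ₗ κ,
    ε.surjective.comp ((Submodule.mkQ_surjective _).comp hκ), fun z => ?_⟩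
  refine (LinearEquiv.map_eq_zero_iff ε).trans
    ((Submodule.Quotient.mk_eq_zero _).trans ⟨?_, ?_⟩)
  · rintro ⟨t, ht⟩
    exact ⟨t, congrArg Subtype.val ht⟩
  · rintro ⟨t, ht⟩
    exact ⟨t, Subtype.ext ht⟩

variable {A B C : ModuleCat.{u} R} (f : A ⟶ B) (g : B ⟶ C) (w : f ≫ g = 0)

/-- The map induced by `g` from the cokernel of `f` onto the image of `g`. -/
noncomputable def cokerToRange : (B ⧸ LinearMap.range f.hom) →ₗ[R] LinearMap.range g.hom :=
  (LinearMap.range f.hom).liftQ g.hom.rangeRestrict <| by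
    rintro _ ⟨a, rfl⟩
    exact Subtype.ext (congrArg (fun h => h.hom a) w)

theorem cokerToRange_surjective : Function.Surjective (cokerToRange f g w) := by
  rintro ⟨_, b, rfl⟩
  exact ⟨Submodule.Quotient.mk b, rfl⟩

/-- The exact sequence `0 → im g → C → coker g → 0`. -/
noncomputable abbrev rangeShortComplex : ShortComplex (ModuleCat.{u} R) :=
  ModuleCat.shortComplexOfCompEqZero (LinearMap.range g.hom).subtype (LinearMap.range g.hom).mkQ
    (LinearMap.exact_subtype_mkQ _).linearMap_comp_eq_zero

theorem rangeShortComplex_shortExact : (rangeShortComplex g).ShortExact :=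
  ModuleCat.shortComplex_shortExact _ (LinearMap.exact_subtype_mkQ _)
    (Submodule.injective_subtype _) (Submodule.mkQ_surjective _)

/-- Since `C` is projective, `Ext^(n+2)(coker g, M)` is `Ext^(n+1)(im g, M)`; the sequence `0 → ker
→ coker f → im g → 0` then leads to `coker f`. -/
theorem serre_extModule_coker_succ [Projective C] {n : ℕ}
    (hN : S (extModule (.of R (LinearMap.ker (cokerToRange f g w))) M (n + 1)))
    (h : S (extModule (.of R (C ⧸ LinearMap.range g.hom)) M (n + 2))) :
    S (extModule (.of R (B ⧸ LinearMap.range f.hom)) M (n + 1)) :=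
  serre_extModule_X₂ (LinearMap.shortExact_shortComplexKer (cokerToRange_surjective f g w))
    ((serre_extModule_succ_iff (rangeShortComplex_shortExact g)).mp h) hN

theorem serre_extModule_coker_of_succ [Projective C] {n : ℕ}
    (hN : S (extModule (.of R (LinearMap.ker (cokerToRange f g w))) M n))
    (h : S (extModule (.of R (B ⧸ LinearMap.range f.hom)) M (n + 1))) :
    S (extModule (.of R (C ⧸ LinearMap.range g.hom)) M (n + 2)) :=
  (serre_extModule_succ_iff (rangeShortComplex_shortExact g)).mpr
    (serre_extModule_X₃ (LinearMap.shortExact_shortComplexKer (cokerToRange_surjective f g w)) hN h)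

/-- The homology is `Hom(coker f, M)` modulo the image of `Hom(C, M)`. Inside it, `Hom(im g, M)`
modulo that image is `Ext^1(coker g, M)`, and what remains embeds in `Hom(ker, M)`. -/
theorem exists_exact_ext_one_homology [Projective C] {T : ShortComplex (ModuleCat.{u} R)}
    (e₁ : (C ⟶ M) ≃ₗ[R] T.X₁) (e₂ : (B ⟶ M) ≃ₗ[R] T.X₂)
    (he₁ : ∀ u, T.f (e₁ u) = e₂ (g ≫ u)) (he₂ : ∀ u : B ⟶ M, T.g (e₂ u) = 0 ↔ f ≫ u = 0) :
    ∃ (α : extModule (.of R (C ⧸ LinearMap.range g.hom)) M 1 →ₗ[R] T.homology)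
      (β : T.homology →ₗ[R] extModule (.of R (LinearMap.ker (cokerToRange f g w))) M 0),
      Function.Injective α ∧ Function.Exact α β := by
  obtain ⟨π, hπ, hπ₀⟩ := exists_ext_zero_to_homology f T e₂ he₂
  have hT := rangeShortComplex_shortExact g
  have hK := LinearMap.shortExact_shortComplexKer (cokerToRange_surjective f g w)
  let δ := hT.extClass.precompOfLinear R M (add_comm 1 0)
  let j := (Abelian.Ext.mk₀ (rangeShortComplex g).f).precompOfLinear R M (zero_add 0)
  let c := (Abelian.Ext.mk₀ (cokerToRange f g w).shortComplexKer.g).precompOfLinear R M (zero_add 0)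
  let r := (Abelian.Ext.mk₀ (cokerToRange f g w).shortComplexKer.f).precompOfLinear R M (zero_add 0)
  -- The next term is `Ext^1(C, M)`, zero because `C` is projective.
  have hδ : Function.Surjective δ := fun z =>
    (extModule_exact_X₃ hT 0 z).mp (Abelian.Ext.eq_zero_of_projective (P := C) _)
  have hjδ : Function.Exact j δ := extModule_exact_X₁ hT 0
  have hcr : Function.Exact c r := extModule_exact_X₂ hK 0
  have hc : Function.Injective c :=
    have := hK.epi_g
    Abelian.Ext.precomp_mk₀_injective_of_epi M (cokerToRange f g w).shortComplexKer.g
  have hcj (v : Abelian.Ext C M 0) : ModuleCat.ofHom (LinearMap.range f.hom).mkQ ≫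
      Abelian.Ext.linearEquiv₀ (R := R) (c (j v)) =
        g ≫ Abelian.Ext.linearEquiv₀ (R := R) v := by
    refine ((congrArg _ (linearEquiv₀_mk₀_comp _ _)).trans (congrArg _ (congrArg _
      (linearEquiv₀_mk₀_comp _ _)))).trans ?_
    rfl
  have hπ' (z) : π z = 0 ↔ ∃ v, c (j v) = z := by
    rw [hπ₀]
    constructor
    · rintro ⟨t, ht⟩
      obtain ⟨u, rfl⟩ := e₁.surjective t
      obtain ⟨v, rfl⟩ := (Abelian.Ext.linearEquiv₀ (R := R)).surjective u
      rw [he₁] at ht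
      refine ⟨v, (Abelian.Ext.linearEquiv₀ (R := R)).injective ?_⟩
      have : Epi (ModuleCat.ofHom (LinearMap.range f.hom).mkQ) :=
        (ModuleCat.epi_iff_surjective _).mpr (Submodule.mkQ_surjective _)
      rw [← cancel_epi (ModuleCat.ofHom (LinearMap.range f.hom).mkQ), ← e₂.injective ht]
      exact hcj v
    · rintro ⟨v, rfl⟩
      exact ⟨e₁ (Abelian.Ext.linearEquiv₀ (R := R) v), (he₁ _).trans (congrArg e₂ (hcj v).symm)⟩
  exact LinearMap.exists_injective_exact j δ c r π hδ hjδ hc hcr hπ hπ'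

end HomCohomology

/-! ### Dimension shifting along a complex of projectives. -/

section ChainComplex

variable {R : Type u} [CommRing R] {S : ObjectProperty (ModuleCat.{u} R)} [S.IsSerreClass]
  {M : ModuleCat.{u} R} (K : ChainComplex (ModuleCat.{u} R) ℕ)

theorem serre_linearYonedaObj_homology_zero :
    S ((K.linearYonedaObj R M).homology 0) ↔
      S (extModule (.of R (K.X 0 ⧸ LinearMap.range (K.d 1 0).hom)) M 0) := by
  -- Degree 0 has no predecessor; the default one is 0 itself, with zero differential.
  let T := (K.linearYonedaObj R M).sc' 0 0 1
  obtain ⟨π, hπ, hπ₀⟩ := exists_ext_zero_to_homology (M := M) (K.d 1 0) T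
    (LinearEquiv.refl R (K.X 0 ⟶ M)) fun u => Iff.rfl
  have hf : T.f = 0 := (K.linearYonedaObj R M).shape 0 0 (by simp)
  have hinj : Function.Injective π := by
    rw [injective_iff_map_eq_zero]
    intro z hz
    obtain ⟨t, ht⟩ := (hπ₀ z).mp hz
    rw [hf] at ht
    have : Epi (ModuleCat.ofHom (LinearMap.range (K.d 1 0).hom).mkQ) :=
      (ModuleCat.epi_iff_surjective _).mpr (Submodule.mkQ_surjective _)
    refine (Abelian.Ext.linearEquiv₀ (R := R)).map_eq_zero_iff.mp ?_
    rw [← cancel_epi (ModuleCat.ofHom (LinearMap.range (K.d 1 0).hom).mkQ), Limits.comp_zero]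
    exact ht.symm
  refine (S.prop_iff_of_iso (ShortComplex.homologyMapIso
    ((K.linearYonedaObj R M).isoSc' 0 0 1 (by simp) (by simp)))).trans ?_
  exact ⟨serre_of_injective S π hinj, serre_of_surjective S π hπ⟩

/-- The kernel of the map that `d_{p+1}` induces on the cokernel of `d_{p+2}`: the homology
in degree `p + 1`. -/
noncomputable abbrev cokerKernel (p : ℕ) : ModuleCat.{u} R :=
  .of R (LinearMap.ker (cokerToRange (K.d (p + 2) (p + 1)) (K.d (p + 1) p) (K.d_comp_d _ _ _)))

variable [∀ p, Projective (K.X p)]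

theorem serre_linearYonedaObj_homology_succ (m : ℕ) (h : S (extModule (cokerKernel K m) M 0)) :
    S ((K.linearYonedaObj R M).homology (m + 1)) ↔
      S (extModule (.of R (K.X m ⧸ LinearMap.range (K.d (m + 1) m).hom)) M 1) := by
  let T := (K.linearYonedaObj R M).sc' m (m + 1) (m + 2)
  obtain ⟨α, β, hα, hαβ⟩ := exists_exact_ext_one_homology (M := M) (T := T) (K.d (m + 2) (m + 1))
    (K.d (m + 1) m) (K.d_comp_d _ _ _) (LinearEquiv.refl R (K.X m ⟶ M))
    (LinearEquiv.refl R (K.X (m + 1) ⟶ M)) (fun u => rfl) fun u => Iff.rfl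
  refine (S.prop_iff_of_iso (ShortComplex.homologyMapIso
    ((K.linearYonedaObj R M).isoSc' m (m + 1) (m + 2) (by simp) (by simp)))).trans ?_
  exact ⟨serre_of_injective S α hα, fun h₁ => serre_of_exact S α β hαβ h₁ h⟩

/-- Let `K` be a complex of projective modules with homology `H_p`. If `Ext^j(H_p, M)` lies in a
Serre class for all `p ≥ 1` and `j < n`, then `Ext^n(H_0, M)` lies in it if and only if
`H^n(Hom(K, M))` does. -/
theorem serre_linearYonedaObj_homology_iff (n : ℕ)
    (hK : ∀ p, ∀ j < n, S (extModule (cokerKernel K p) M j)) :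
    S ((K.linearYonedaObj R M).homology n) ↔
      S (extModule (.of R (K.X 0 ⧸ LinearMap.range (K.d 1 0).hom)) M n) := by
  cases n with
  | zero => exact serre_linearYonedaObj_homology_zero K
  | succ m =>
    rw [serre_linearYonedaObj_homology_succ K m (hK m 0 m.succ_pos)]
    -- Each step down in `q` raises the Ext degree by one. It uses `Ext^j` and `Ext^(j+1)` of
    -- `H_(q+1)`, and `j + 1 ≤ m < n`.
    have (q : ℕ) : ∀ j, q + j = m →
        (S (extModule (.of R (K.X q ⧸ LinearMap.range (K.d (q + 1) q).hom)) M (j + 1)) ↔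
          S (extModule (.of R (K.X 0 ⧸ LinearMap.range (K.d 1 0).hom)) M (m + 1))) := by
      induction q with
      | zero =>
        intro j hj
        obtain rfl : j = m := by omega
        rfl
      | succ q ih =>
        intro j hj
        rw [← ih (j + 1) (by omega)]
        exact ⟨serre_extModule_coker_of_succ _ _ _ (hK q j (by omega)),
          serre_extModule_coker_succ _ _ _ (hK q (j + 1) (by omega))⟩
    exact this m 0 rfl

end ChainComplex

/-! ### Homology of the Koszul complex. -/

section Koszul

variable {R : Type u} [CommRing R]

theorem ExteriorAlgebra.ι_mul_mem_exteriorPower {L : Type u} [AddCommGroup L] [Module R L] (v : L)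
    {p : ℕ} {ω : ExteriorAlgebra R L} (hω : ω ∈ ⋀[R]^p L) :
    ExteriorAlgebra.ι R v * ω ∈ ⋀[R]^(p + 1) L := by
  rw [ExteriorAlgebra.exteriorPower, pow_succ']
  exact Submodule.mul_mem_mul ⟨v, rfl⟩ hω

/-- Exterior multiplication by `v` contracts the multiplication by `φ v`. -/
theorem smul_mem_range_koszulD {L : Type u} [AddCommGroup L] [Module R L] (φ : Module.Dual R L)
    (v : L) (p : ℕ) (ω : ⋀[R]^(p + 1) L) (hω : koszulD φ p ω = 0) :
    φ v • ω ∈ LinearMap.range (koszulD φ (p + 1)) := by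
  refine ⟨⟨_, ExteriorAlgebra.ι_mul_mem_exteriorPower v ω.2⟩, Subtype.ext ?_⟩
  refine (CliffordAlgebra.contractLeft_ι_mul (Q := (0 : QuadraticForm R L)) φ v ω.1).trans ?_
  have : CliffordAlgebra.contractLeft (Q := (0 : QuadraticForm R L)) φ ω.1 = 0 :=
    congrArg Subtype.val hω
  rw [this, mul_zero, sub_zero]
  rfl

variable {k : ℕ} (x : Fin k → R)

theorem koszulComplex_d (p : ℕ) : ((koszulComplex x).d (p + 1) p).hom =
    koszulD (Fintype.linearCombination R x) p :=
  congrArg ModuleCat.Hom.hom (ChainComplex.of_d (fun p => ModuleCat.of R (⋀[R]^p (Fin k → R)))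
    (fun p => ModuleCat.ofHom (koszulD (Fintype.linearCombination R x) p)) p)

instance (p : ℕ) : Projective ((koszulComplex x).X p) :=
  inferInstanceAs (Projective (ModuleCat.of R (⋀[R]^p (Fin k → R))))

instance (p : ℕ) : Module.Finite R ((koszulComplex x).X p) :=
  inferInstanceAs (Module.Finite R (⋀[R]^p (Fin k → R)))

/-- Each `a ∈ I` is `φ v` for some `v`, and multiplication by `φ v` is null-homotopic. -/
theorem le_annihilator_cokerKernel_koszulComplex (p : ℕ) :
    Ideal.span (Set.range x) ≤ Module.annihilator R (cokerKernel (koszulComplex x) p) := by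
  intro a ha
  obtain ⟨v, rfl⟩ : a ∈ LinearMap.range (Fintype.linearCombination R x) := by
    rwa [Fintype.range_linearCombination]
  rw [Module.mem_annihilator]
  rintro ⟨z, hz⟩
  obtain ⟨ω, rfl⟩ := Submodule.mkQ_surjective _ z
  refine Subtype.ext ((Submodule.Quotient.mk_eq_zero _).mpr ?_)
  have hω : ((koszulComplex x).d (p + 1) p).hom ω = 0 := congrArg Subtype.val hz
  rw [koszulComplex_d] at hω ⊢
  exact smul_mem_range_koszulD _ v p ω hω

theorem zeroEquiv_koszulD_oneEquiv_symm {L : Type u} [AddCommGroup L] [Module R L]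
    (φ : Module.Dual R L) (v : L) :
    exteriorPower.zeroEquiv R L (koszulD φ 0 ((exteriorPower.oneEquiv R L).symm v)) = φ v := by
  have h : koszulD φ 0 ((exteriorPower.oneEquiv R L).symm v) =
      φ v • exteriorPower.ιMulti R 0 (fun i => i.elim0 : Fin 0 → L) := by
    refine Subtype.ext ?_
    rw [exteriorPower.oneEquiv_symm_apply]
    change CliffordAlgebra.contractLeft (Q := (0 : QuadraticForm R L)) φ
      (ExteriorAlgebra.ιMulti R 1 fun _ => v) = φ v • ExteriorAlgebra.ιMulti R 0 _
    rw [ExteriorAlgebra.ιMulti_zero_apply, ExteriorAlgebra.ιMulti_apply]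
    simp only [List.ofFn_succ, List.ofFn_zero, List.prod_cons, List.prod_nil, mul_one]
    exact (CliffordAlgebra.contractLeft_ι (Q := 0) φ v).trans (Algebra.algebraMap_eq_smul_one _)
  rw [h, map_smul, exteriorPower.zeroEquiv_ιMulti, smul_eq_mul, mul_one]

theorem map_zeroEquiv_range_koszulD {L : Type u} [AddCommGroup L] [Module R L]
    (φ : Module.Dual R L) :
    (LinearMap.range (koszulD φ 0)).map (exteriorPower.zeroEquiv R L).toLinearMap =
      LinearMap.range φ := by
  rw [← LinearMap.range_comp,
    ← LinearMap.range_comp_of_range_eq_top _ (exteriorPower.oneEquiv R L).symm.range]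
  exact congrArg LinearMap.range (LinearMap.ext (zeroEquiv_koszulD_oneEquiv_symm _))

/-- `H_0` of the Koszul complex. -/
theorem nonempty_koszulComplex_coker_iso :
    Nonempty (ModuleCat.of R ((koszulComplex x).X 0 ⧸
      LinearMap.range ((koszulComplex x).d 1 0).hom) ≅
        .of R (R ⧸ Ideal.span (Set.range x))) := by
  refine ⟨(Submodule.Quotient.equiv _ _ (exteriorPower.zeroEquiv R (Fin k → R)) ?_).toModuleIso⟩
  rw [koszulComplex_d]
  exact map_zeroEquiv_range_koszulD _ |>.trans (Fintype.range_linearCombination R x)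

theorem serre_koszulCohomology_iff [IsNoetherianRing R] {S : ObjectProperty (ModuleCat.{u} R)}
    [S.IsSerreClass] {M : ModuleCat.{u} R} (n : ℕ) :
    (∀ i ≤ n, S (extModule (.of R (R ⧸ Ideal.span (Set.range x))) M i)) ↔
      ∀ i ≤ n, S (koszulCohomology x M i) := by
  obtain ⟨e⟩ := nonempty_koszulComplex_coker_iso x
  have key (n : ℕ) (h : ∀ i < n, S (extModule (.of R (R ⧸ Ideal.span (Set.range x))) M i)) :
      S (koszulCohomology x M n) ↔ S (extModule (.of R (R ⧸ Ideal.span (Set.range x))) M n) := by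
    refine (serre_linearYonedaObj_homology_iff (koszulComplex x) n fun p j hj => ?_).trans
      ⟨serre_extModule_of_iso e, serre_extModule_of_iso e.symm⟩
    exact serre_extModule_of_le_radical_annihilator _ j (fun i hi => h i (hi.trans_lt hj)) _
      ((le_annihilator_cokerKernel_koszulComplex x p).trans Ideal.le_radical)
  refine ⟨fun h i hi => (key i fun j hj => h j (hj.le.trans hi)).mpr (h i hi), fun h i => ?_⟩
  -- The comparison in degree `i` presupposes the Ext condition below `i`, so this direction needs
  -- induction.
  induction i using Nat.strong_induction_on with
  | _ i ih => exact fun hi => (key i fun j hj => ih j hj (hj.le.trans hi)).mp (h i hi)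

end Koszul

theorem mainTheorem4 {R : Type u} [CommRing R] [IsNoetherianRing R]
    (S : ObjectProperty (ModuleCat.{u} R)) [S.IsSerreClass]
    (I J : Ideal R) (hIJ : I.radical = J.radical)
    {k l : ℕ} (x : Fin k → R) (hx : Ideal.span (Set.range x) = I)
    (y : Fin l → R) (hy : Ideal.span (Set.range y) = J)
    (M : ModuleCat.{u} R) (n : ℕ) :
    List.TFAE [
      ∀ i ≤ n, S (extModule (ModuleCat.of R (R ⧸ I)) M i),
      ∀ i ≤ n, S (extModule (ModuleCat.of R (R ⧸ J)) M i),
      ∀ i ≤ n, S (koszulCohomology x M i),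
      ∀ i ≤ n, S (koszulCohomology y M i)] := by
  tfae_have 1 ↔ 2 :=
    ⟨fun h i hi => serre_extModule_of_le_radical_annihilator I i (fun j hj => h j (hj.trans hi)) _
      (by rw [Ideal.annihilator_quotient, ← hIJ]; exact Ideal.le_radical),
    fun h i hi => serre_extModule_of_le_radical_annihilator J i (fun j hj => h j (hj.trans hi)) _
      (by rw [Ideal.annihilator_quotient, hIJ]; exact Ideal.le_radical)⟩
  tfae_have 1 ↔ 3 := by
    subst hx
    exact serre_koszulCohomology_iff x n
  tfae_have 2 ↔ 4 := by
    subst hy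
    exact serre_koszulCohomology_iff y n
  tfae_finish
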